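/- Consider the triangular lattice in the plane (unit equilateral triangles as faces). A polyiamond is a nonempty finite set of faces that is connected through shared edges; its area is its number of faces, and its site-perimeter $s(P)$ is the number of faces not in $P$ that share at least one edge with a face of $P$. A bar $B(l)$ is the set of $2l-1$ faces obtained from an equilateral lattice triangle of side length $l$ by removing an equilateral triangle of side length $l-1$ sharing a corner with it; its larger base is the side, of length $l$, opposite to that corner. For $r\ge 1$ let $E_{B_0}(r)=E(r)$ be the regular lattice hexagon of side length $r$. For $i=1,\dots,6$, $E_{B_i}(r)$ is obtained from $E_{B_{i-1}}(r)$ by attaching to one of its sides, along its larger base, a bar $B(l_i)$, where $l_1=r$, $l_2=\dots=l_5=r+1$, $l_6=r+2$, in such a way that the result is contained in a regular hexagon $E(r+1)$. The polyiamonds $E_{B_i}(r)$ with $r\ge1$, $0\le i\le 6$ are called quasi-regular hexagons. **Proposition.** Quasi-regular hexagons are the unique polyiamonds of maximal area for fixed site-perimeter. That is, for every integer $s\ge 6$, a polyiamond $P$ has site-perimeter $s$ and has maximal area among all polyiamonds of site-perimeter $s$ if and only if $P$ is a quasi-regular hexagon with $s(P)=s$. More precisely, if $s=6r+i$ with $r\ge1$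 and $0\le i\le5$, then the polyiamonds of maximal area among those of site-perimeter $s$ are exactly the polyiamonds $E_{B_i}(r)$; these exist, and they form a single class up to translations of the lattice and rotations by multiples of $\pi/3$. -/

import Mathlib

namespace TriLattice

/-- A face of the triangular lattice. The lattice vertex with coordinates `(x, y) : ℤ × ℤ` is the
point `x • (1, 0) + y • (1/2, √3/2)` of the plane. The face `(x, y, true)` is the upward unit triangle
with lower left corner `(x, y)`, and `(x, y, false)` is the downward unit triangle which shares with
it the edge from `(x + 1, y)` to `(x, y + 1)`. -/
abbrev Face := ℤ × ℤ × Bool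

/-- The three corners of a face. -/
def vertices : Face → Finset (ℤ × ℤ)
  | (x, y, true) => {(x, y), (x + 1, y), (x, y + 1)}
  | (x, y, false) => {(x + 1, y), (x, y + 1), (x + 1, y + 1)}

/-- Two faces are adjacent when they share an edge, i.e. exactly two corners. -/
def faceGraph : SimpleGraph Face where
  Adj f g := (vertices f ∩ vertices g).card = 2
  symm := ⟨fun f g h => by rwa [Finset.inter_comm]⟩
  loopless := ⟨by
    rintro ⟨x, y, _ | _⟩ h <;> simp [vertices] at h⟩

/-- A polyiamond: a (nonempty) finite edge-connected set of faces. Its area is `P.card`. -/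
def IsPolyiamond (P : Finset Face) : Prop :=
  (faceGraph.induce (P : Set Face)).Connected

/-- The site-perimeter: the number of faces outside `P` sharing at least one edge with `P`. -/
noncomputable def sitePerimeter (P : Finset Face) : ℕ :=
  {f : Face | f ∉ P ∧ ∃ g ∈ P, faceGraph.Adj f g}.ncard

/-- `P` has the largest area among all polyiamonds of site-perimeter `s`. -/
def IsAreaMaximizer (s : ℕ) (P : Finset Face) : Prop :=
  IsPolyiamond P ∧ sitePerimeter P = s ∧
    ∀ Q : Finset Face, IsPolyiamond Q → sitePerimeter Q = s → Q.card ≤ P.card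

/-- Translation of a face by the lattice vector `t`. -/
def translate (t : ℤ × ℤ) (f : Face) : Face := (f.1 + t.1, f.2.1 + t.2, f.2.2)

/-- Counter-clockwise rotation of faces by `π / 3` about the vertex `(0, 0)`
(on vertices it is `(x, y) ↦ (-y, x + y)`, see `vertices_rotate`). -/
def rotate : Face → Face
  | (x, y, true) => (-y - 1, x + y, false)
  | (x, y, false) => (-y - 1, x + y + 1, true)

/-- Rotation by `k * π / 3` about `(0, 0)` followed by translation by `t`. -/
def move (k : ℕ) (t : ℤ × ℤ) (f : Face) : Face := translate t (rotate^[k] f)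

/-- `Q` is obtained from `P` by a rotation by a multiple of `π / 3` and a translation. -/
def LatticeCongruent (P Q : Finset Face) : Prop :=
  ∃ (k : ℕ) (t : ℤ × ℤ), Q = P.image (move k t)

/-- The regular hexagon `E(r)` of radius (side length) `r` centred at the vertex `(0, 0)`:
all faces contained in it. -/
noncomputable def hexagon (r : ℕ) : Finset Face :=
  (Finset.Icc (-r : ℤ) r ×ˢ Finset.Icc (-r : ℤ) r ×ˢ Finset.univ).filter fun f =>
    ∀ p ∈ vertices f, |p.1| ≤ (r : ℤ) ∧ |p.2| ≤ (r : ℤ) ∧ |p.1 + p.2| ≤ (r : ℤ)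

/-- The upward equilateral triangle of side length `l` with corners `(0, 0)`, `(l, 0)`, `(0, l)`. -/
noncomputable def triangle (l : ℕ) : Finset Face :=
  (Finset.Icc (0 : ℤ) l ×ˢ Finset.Icc (0 : ℤ) l ×ˢ Finset.univ).filter fun f =>
    ∀ p ∈ vertices f, 0 ≤ p.1 ∧ 0 ≤ p.2 ∧ p.1 + p.2 ≤ (l : ℤ)

/-- The bar `B(l)` (for `1 ≤ l`) with larger base the segment from `(0, 0)` to `(l, 0)`: the triangle
of side `l` minus the triangle of side `l - 1` that has the same top corner. -/
noncomputable def bar (l : ℕ) : Finset Face := triangle l \ (triangle (l - 1)).image (translate (0, 1))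

/-- The `l` faces on the other side of the larger base of `bar l`. -/
def underBar (l : ℕ) : Finset Face :=
  (Finset.range l).image fun j : ℕ => ((j : ℤ), (-1 : ℤ), false)

/-- `P` is obtained from `Q` by attaching outside `Q`, along its larger base, a bar `B(l)`
in any position and orientation. -/
def AttachBar (l : ℕ) (Q P : Finset Face) : Prop :=
  ∃ (k : ℕ) (t : ℤ × ℤ), (underBar l).image (move k t) ⊆ Q ∧
    Disjoint Q ((bar l).image (move k t)) ∧ P = Q ∪ (bar l).image (move k t)

/-- Length of the larger base of the bar attached to `E_{B_i}(r)` in order to obtain `E_{B_{i+1}}(r)`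
(for `i ≤ 5`): `r` for the first bar, `r + 2` for the sixth, `r + 1` otherwise. -/
def barLength (r i : ℕ) : ℕ := if i = 0 then r else if i = 5 then r + 2 else r + 1

/-- `P` is a regular hexagon of radius `r`, anywhere in the lattice. -/
def IsRegularHexagon (r : ℕ) (P : Finset Face) : Prop :=
  ∃ t : ℤ × ℤ, P = (hexagon r).image (translate t)

/-- `IsEB r i P`: `P` is an `E_{B_i}(r)`, i.e. it arises from a regular hexagon of radius `r` by
attaching successively `i` bars so that each time the result is contained in a regular hexagon of
radius `r + 1`. -/
def IsEB (r : ℕ) : ℕ → Finset Face → Prop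
  | 0, P => IsRegularHexagon r P
  | i + 1, P => (∃ Q, IsEB r i Q ∧ AttachBar (barLength r i) Q P) ∧
      ∃ H, IsRegularHexagon (r + 1) H ∧ P ⊆ H

/-- A quasi-regular hexagon. -/
def IsQuasiRegularHexagon (P : Finset Face) : Prop :=
  ∃ r i : ℕ, 1 ≤ r ∧ i ≤ 6 ∧ IsEB r i P

theorem vertices_rotate (f : Face) :
    vertices (rotate f) = (vertices f).image fun p => (-p.2, p.1 + p.2) := by
  obtain ⟨x, y, _ | _⟩ := f <;> ext ⟨a, b⟩ <;>
    simp only [vertices, rotate, Finset.image_insert, Finset.image_singleton, Finset.mem_insert,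
      Finset.mem_singleton, Prod.mk.injEq] <;> lia

theorem vertices_translate (t : ℤ × ℤ) (f : Face) :
    vertices (translate t f) = (vertices f).image fun p => p + t := by
  obtain ⟨x, y, _ | _⟩ := f <;> obtain ⟨s, t⟩ := t <;> ext ⟨a, b⟩ <;>
    simp only [vertices, translate, Finset.image_insert, Finset.image_singleton, Finset.mem_insert,
      Finset.mem_singleton, Prod.mk.injEq, Prod.mk_add_mk] <;> lia

end TriLattice

open TriLattice

/-!
Measure a face by the three signed distances `coord f j` of its centre from the axes, rounded down;
`region a b` is the set of faces between six lattice lines. In each of the three directions every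
row that meets a polyiamond `P` has a row end on either side. A face outside `P` serves as a row end
for at most two rows, so the number of rows of `P`, over all directions, is at most its
site-perimeter. By connectedness the bounding region of `P` has the same rows, hence it has
site-perimeter at most that of `P`, and area at least that of `P`.

If `region a b` has widths `w j = b j - a j` and `D = ∑ j, (a j + b j)`, then its site-perimeter is
`∑ j, w j` and twice its area is `(∑ j, w j) ^ 2 - 2 * ∑ j, w j ^ 2 - D ^ 2`. For a given
site-perimeter this is maximal exactly if the region is balanced: the widths differ by at most one
and `|D| ≤ 1`. Attaching a bar moves one of the six lines by one step; the length of a side of a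
balanced region never exceeds the prescribed length of the next bar, and it equals that length
exactly if moving that side keeps the region balanced.
-/

namespace TriLattice

section Coordinates

/-- The sign by which a coordinate changes when an edge of `f` is crossed: `-1` for an upward face
and `1` for a downward face. -/
def sgn (f : Face) : ℤ := if f.2.2 then -1 else 1

/-- The barycentric coordinates of a face: `f` lies in the strip
`coord f j ≤ p j ≤ coord f j + 1` for each `j`, where a lattice vertex `(x, y)` has the
barycentric coordinates `p = (x, y, -x - y)`. -/
def coord (f : Face) : Fin 3 → ℤ := ![f.1, f.2.1, -f.1 - f.2.1 - if f.2.2 then 1 else 2]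

/-- The face on the other side of the edge of `f` that is parallel to the lines `p j = const`. -/
def neighbor (j : Fin 3) (f : Face) : Face :=
  (f.1 + if j = 0 then sgn f else 0, f.2.1 + if j = 1 then sgn f else 0, !f.2.2)

theorem sum_univ_eq_add_cyclic {M : Type*} [AddCommMonoid M] (u : Fin 3 → M) (j : Fin 3) :
    ∑ k, u k = u j + u (j + 1) + u (j + 2) := by
  fin_cases j <;> simp only [Fin.sum_univ_three, Fin.reduceFinMk, Fin.reduceAdd, Fin.zero_eta,
    zero_add, Fin.isValue] <;> abel

theorem forall_fin_three_cyclic {p : Fin 3 → Prop} (j : Fin 3) :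
    (∀ k, p k) ↔ p j ∧ p (j + 1) ∧ p (j + 2) := by
  revert j
  simp [Fin.forall_fin_succ]
  tauto

theorem sgn_eq_one_or_neg_one (f : Face) : sgn f = 1 ∨ sgn f = -1 := by
  unfold sgn
  split_ifs <;> simp

theorem two_mul_sum_coord (f : Face) : 2 * ∑ j, coord f j = -3 - sgn f := by
  rw [Fin.sum_univ_three]
  unfold coord sgn
  split_ifs <;> simp <;> ring

theorem coord_injective : Function.Injective coord := by
  rintro ⟨x, y, _ | _⟩ ⟨x', y', _ | _⟩ h <;>
    simp [coord, funext_iff, Fin.forall_fin_succ] at h ⊢ <;> lia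

theorem sgn_neighbor (j : Fin 3) (f : Face) : sgn (neighbor j f) = -sgn f := by
  obtain ⟨x, y, _ | _⟩ := f <;> simp [sgn, neighbor]

theorem coord_neighbor (j : Fin 3) (f : Face) :
    coord (neighbor j f) = coord f + Pi.single j (sgn f) := by
  obtain ⟨x, y, _ | _⟩ := f <;> fin_cases j <;> ext k <;> fin_cases k <;>
    simp [coord, neighbor, sgn] <;> ring

theorem neighbor_neighbor (j : Fin 3) (f : Face) : neighbor j (neighbor j f) = f :=
  coord_injective <| by simp [coord_neighbor, sgn_neighbor, add_assoc, ← Pi.single_add]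

theorem adj_iff_exists_eq_neighbor {f g : Face} :
    faceGraph.Adj f g ↔ ∃ j, g = neighbor j f := by
  change (vertices f ∩ vertices g).card = 2 ↔ _
  rw [← Finset.filter_mem_eq_inter, Finset.card_filter]
  obtain ⟨x, y, _ | _⟩ := f <;> obtain ⟨x', y', _ | _⟩ := g <;>
    simp [-Finset.sum_boole, Finset.sum_insert, vertices, neighbor, sgn, Fin.exists_fin_succ] <;>
    split_ifs <;> lia

theorem neighbor_adj (j : Fin 3) (f : Face) : faceGraph.Adj f (neighbor j f) :=
  adj_iff_exists_eq_neighbor.2 ⟨j, rfl⟩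

theorem coord_translate (t : ℤ × ℤ) (f : Face) :
    coord (translate t f) = coord f + ![t.1, t.2, -t.1 - t.2] := by
  obtain ⟨x, y, _ | _⟩ := f <;> ext j <;> fin_cases j <;> simp [coord, translate] <;> ring

theorem coord_rotate (f : Face) (j : Fin 3) : coord (rotate f) j = -1 - coord f (j + 1) := by
  obtain ⟨x, y, _ | _⟩ := f <;> fin_cases j <;> simp [coord, rotate] <;> ring

end Coordinates

section Regions

/-- The hexagonal region `{f | a j ≤ coord f j < b j for all j}`: the faces between the lines
`p j = a j` and `p j = b j`. Bars, triangles and hexagons are all of this form. -/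
noncomputable def region (a b : Fin 3 → ℤ) : Finset Face :=
  (Finset.Icc a (b - 1)).preimage coord coord_injective.injOn

theorem mem_region {a b : Fin 3 → ℤ} {f : Face} :
    f ∈ region a b ↔ ∀ j, a j ≤ coord f j ∧ coord f j < b j := by
  simp only [region, Finset.mem_preimage, Finset.mem_Icc, Pi.le_def, Pi.sub_apply, Pi.one_apply,
    Int.le_sub_one_iff, forall_and]

theorem neg_translate_translate (t : ℤ × ℤ) (f : Face) : translate t (translate (-t) f) = f := by
  simp [translate]

theorem rotate_iterate_six (f : Face) : rotate^[6] f = f := by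
  obtain ⟨x, y, _ | _⟩ := f <;> simp [rotate] <;> lia

theorem region_image_translate (a b : Fin 3 → ℤ) (t : ℤ × ℤ) :
    (region a b).image (translate t) =
      region (a + ![t.1, t.2, -t.1 - t.2]) (b + ![t.1, t.2, -t.1 - t.2]) := by
  have maps (a b : Fin 3 → ℤ) (t : ℤ × ℤ) (f : Face) : translate t f ∈
      region (a + ![t.1, t.2, -t.1 - t.2]) (b + ![t.1, t.2, -t.1 - t.2]) ↔ f ∈ region a b := by
    simp only [mem_region, coord_translate, Pi.add_apply, add_le_add_iff_right,
      add_lt_add_iff_right]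
  ext f
  rw [← neg_translate_translate t f, maps, Finset.mem_image]
  constructor
  · rintro ⟨g, hg, h⟩
    rw [neg_translate_translate] at h
    rwa [← maps, neg_translate_translate, ← h, maps]
  · exact fun h => ⟨_, h, rfl⟩

theorem region_image_rotate (a b : Fin 3 → ℤ) :
    (region a b).image rotate = region (fun j => -b (j + 1)) fun j => -a (j + 1) := by
  have maps (f : Face) :
      rotate f ∈ region (fun j => -b (j + 1)) (fun j => -a (j + 1)) ↔ f ∈ region a b := by
    simp only [mem_region, coord_rotate]
    rw [← (Equiv.addRight (1 : Fin 3)).forall_congr_right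
      (q := fun j => a j ≤ coord f j ∧ coord f j < b j)]
    refine forall_congr' fun j => ?_
    rw [Equiv.coe_addRight]
    lia
  ext f
  rw [Finset.mem_image]
  constructor
  · rintro ⟨g, hg, rfl⟩
    exact (maps g).2 hg
  · intro h
    rw [← rotate_iterate_six f, Function.iterate_succ_apply', maps] at h
    exact ⟨_, h, rotate_iterate_six f⟩

theorem forall_mem_vertices_iff (f : Face) {p : ℤ × ℤ → Prop} :
    (∀ v ∈ vertices f, p v) ↔ if f.2.2 then p (f.1, f.2.1) ∧ p (f.1 + 1, f.2.1) ∧ p (f.1, f.2.1 + 1)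
      else p (f.1 + 1, f.2.1) ∧ p (f.1, f.2.1 + 1) ∧ p (f.1 + 1, f.2.1 + 1) := by
  obtain ⟨x, y, _ | _⟩ := f <;> simp [vertices]

theorem mem_region_iff {a b : Fin 3 → ℤ} {f : Face} :
    f ∈ region a b ↔ (a 0 ≤ f.1 ∧ f.1 < b 0) ∧ (a 1 ≤ f.2.1 ∧ f.2.1 < b 1) ∧
      a 2 ≤ coord f 2 ∧ coord f 2 < b 2 := by
  simp [mem_region, coord, Fin.forall_fin_succ]

theorem hexagon_eq_region (r : ℕ) : hexagon r = region (fun _ => -r) fun _ => r := by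
  ext ⟨x, y, _ | _⟩ <;> simp only [hexagon, Finset.mem_filter, forall_mem_vertices_iff] <;>
    simp [mem_region_iff, coord, abs_le] <;> omega

theorem triangle_eq_region (l : ℕ) : triangle l = region ![0, 0, -l] ![l, l, 0] := by
  ext ⟨x, y, _ | _⟩ <;> simp only [triangle, Finset.mem_filter, forall_mem_vertices_iff] <;>
    simp [mem_region_iff, coord] <;> omega

theorem bar_eq_region {l : ℕ} (hl : 1 ≤ l) : bar l = region ![0, 0, -l] ![l, 1, 0] := by
  rw [bar, triangle_eq_region, triangle_eq_region, region_image_translate]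
  ext ⟨x, y, _ | _⟩ <;> simp [mem_region_iff, coord] <;> lia

theorem underBar_subset_region_iff {l : ℕ} (hl : 1 ≤ l) {a b : Fin 3 → ℤ} :
    underBar l ⊆ region a b ↔
      (a 0 ≤ 0 ∧ l ≤ b 0) ∧ (a 1 < 0 ∧ 0 ≤ b 1) ∧ a 2 ≤ -l ∧ 0 ≤ b 2 := by
  simp only [underBar, Finset.image_subset_iff, Finset.mem_range, mem_region_iff, coord]
  constructor
  · intro h
    have h_first := h 0 (by lia)
    have h_last := h (l - 1) (by lia)
    simp at h_first h_last
    lia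
  · intro h j hj
    simp
    lia

end Regions

section Motions

/-- The rotation by `π / 3` on lattice vectors. -/
def turn (t : ℤ × ℤ) : ℤ × ℤ := (-t.2, t.1 + t.2)

theorem rotate_iterate_six_mul (k : ℕ) (f : Face) : rotate^[6 * k] f = f := by
  rw [Function.iterate_mul, funext rotate_iterate_six, Function.iterate_fixed rfl]

theorem translate_translate (t t' : ℤ × ℤ) (f : Face) :
    translate t (translate t' f) = translate (t' + t) f := by
  simp only [translate, Prod.fst_add, Prod.snd_add, add_assoc]

theorem rotate_iterate_translate (k : ℕ) (t : ℤ × ℤ) (f : Face) :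
    rotate^[k] (translate t f) = translate (turn^[k] t) (rotate^[k] f) := by
  have rotate_translate (t : ℤ × ℤ) (f : Face) :
      rotate (translate t f) = translate (turn t) (rotate f) := by
    obtain ⟨x, y, _ | _⟩ := f <;> simp [translate, rotate, turn] <;> lia
  induction k with
  | zero => rfl
  | succ k ih => simp only [Function.iterate_succ_apply', ih, rotate_translate]

theorem move_move (k k' : ℕ) (t t' : ℤ × ℤ) (f : Face) :
    move k t (move k' t' f) = move (k + k') (turn^[k] t' + t) f := by
  rw [move, move, move, rotate_iterate_translate, translate_translate, Function.iterate_add_apply]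

theorem move_zero : move 0 0 = id := funext fun f => by
  simp only [move, translate, Function.iterate_zero, id_eq, Prod.fst_zero, Prod.snd_zero, add_zero]

theorem exists_leftInverse_move (k : ℕ) (t : ℤ × ℤ) :
    ∃ (k' : ℕ) (t' : ℤ × ℤ), Function.LeftInverse (move k' t') (move k t) := by
  refine ⟨5 * k, -turn^[5 * k] t, fun f => ?_⟩
  rw [move_move, add_neg_cancel, ← Nat.succ_mul, move, rotate_iterate_six_mul, translate,
    Prod.fst_zero, Prod.snd_zero, add_zero, add_zero]

theorem exists_rightInverse_move (k : ℕ) (t : ℤ × ℤ) :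
    ∃ (k' : ℕ) (t' : ℤ × ℤ), Function.RightInverse (move k' t') (move k t) := by
  obtain ⟨k₁, t₁, h₁⟩ := exists_leftInverse_move k t
  obtain ⟨k₂, t₂, h₂⟩ := exists_leftInverse_move k₁ t₁
  exact ⟨k₁, t₁, h₂.eq_rightInverse h₁ ▸ h₂⟩

theorem move_injective (k : ℕ) (t : ℤ × ℤ) : Function.Injective (move k t) :=
  (exists_leftInverse_move k t).choose_spec.choose_spec.injective

theorem LatticeCongruent.symm {P Q : Finset Face} (h : LatticeCongruent P Q) :
    LatticeCongruent Q P := by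
  obtain ⟨k, t, rfl⟩ := h
  obtain ⟨k', t', h'⟩ := exists_leftInverse_move k t
  exact ⟨k', t', by rw [Finset.image_image, h'.comp_eq_id, Finset.image_id]⟩

theorem LatticeCongruent.trans {P Q R : Finset Face} (hPQ : LatticeCongruent P Q)
    (hQR : LatticeCongruent Q R) : LatticeCongruent P R := by
  obtain ⟨k, t, rfl⟩ := hPQ
  obtain ⟨k', t', rfl⟩ := hQR
  exact ⟨k' + k, turn^[k'] t + t', by
    rw [Finset.image_image, ← funext (move_move k' k t' t), Function.comp_def]⟩

theorem attachBar_iff {l : ℕ} {Q P : Finset Face} :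
    AttachBar l Q P ↔ ∃ (k : ℕ) (t : ℤ × ℤ) (R : Finset Face), underBar l ⊆ R ∧
      Disjoint R (bar l) ∧ Q = R.image (move k t) ∧ P = (R ∪ bar l).image (move k t) := by
  constructor
  · rintro ⟨k, t, h_sub, h_disj, rfl⟩
    obtain ⟨k', t', h_right⟩ := exists_rightInverse_move k t
    have hQ : Q = (Q.image (move k' t')).image (move k t) := by
      rw [Finset.image_image, h_right.comp_eq_id, Finset.image_id]
    refine ⟨k, t, Q.image (move k' t'), ?_, ?_, hQ, ?_⟩
    · rwa [← Finset.image_subset_image_iff (move_injective k t), ← hQ]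
    · rwa [← Finset.disjoint_image (move_injective k t), ← hQ]
    · rw [Finset.image_union, ← hQ]
  · rintro ⟨k, t, R, h_sub, h_disj, rfl, rfl⟩
    exact ⟨k, t, Finset.image_subset_image h_sub,
      (Finset.disjoint_image (move_injective k t)).2 h_disj, Finset.image_union _ _⟩

theorem AttachBar.image_move {l : ℕ} {Q P : Finset Face} (h : AttachBar l Q P) (k : ℕ)
    (t : ℤ × ℤ) : AttachBar l (Q.image (move k t)) (P.image (move k t)) := by
  obtain ⟨k', t', R, h_sub, h_disj, rfl, rfl⟩ := attachBar_iff.1 h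
  refine attachBar_iff.2 ⟨k + k', turn^[k] t' + t, R, h_sub, h_disj, ?_, ?_⟩ <;>
    rw [Finset.image_image, ← funext (move_move k k' t t'), Function.comp_def]

end Motions

section Connectedness

theorem IsPolyiamond.nonempty {P : Finset Face} (hP : IsPolyiamond P) : P.Nonempty := by
  obtain ⟨f⟩ := SimpleGraph.Connected.nonempty hP
  exact ⟨f, f.2⟩

theorem coord_neighbor_self (j : Fin 3) (f : Face) :
    coord (neighbor j f) j = coord f j + sgn f := by
  simp [coord_neighbor]

theorem coord_neighbor_of_ne {j k : Fin 3} (h : k ≠ j) (f : Face) :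
    coord (neighbor j f) k = coord f k := by
  simp [coord_neighbor, h]

theorem exists_pos_sgn_mul_coord_sub {f g : Face} (h : f ≠ g) :
    ∃ j, 0 < sgn f * (coord g j - coord f j) := by
  by_contra! h_nonpos
  have h_sum : 0 ≤ ∑ j, sgn f * (coord g j - coord f j) := by
    rw [← Finset.mul_sum, Finset.sum_sub_distrib]
    have hf := two_mul_sum_coord f
    have hg := two_mul_sum_coord g
    rcases sgn_eq_one_or_neg_one f with hf' | hf' <;> rw [hf'] at hf ⊢ <;>
      rcases sgn_eq_one_or_neg_one g with hg' | hg' <;> lia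
  have h_zero := (Finset.sum_eq_zero_iff_of_nonpos fun j _ => h_nonpos j).1
    (le_antisymm (Finset.sum_nonpos fun j _ => h_nonpos j) h_sum)
  refine h (coord_injective (funext fun j => ?_))
  rcases sgn_eq_one_or_neg_one f with hf | hf <;> have := h_zero j (Finset.mem_univ j) <;>
    rw [hf] at this <;> lia

theorem exists_neighbor_closer {f g : Face} (h : f ≠ g) : ∃ j,
    min (coord f j) (coord g j) ≤ coord (neighbor j f) j ∧
    coord (neighbor j f) j ≤ max (coord f j) (coord g j) ∧
    ∑ k, (coord g k - coord (neighbor j f) k).natAbs < ∑ k, (coord g k - coord f k).natAbs := by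
  obtain ⟨j, hj⟩ := exists_pos_sgn_mul_coord_sub h
  refine ⟨j, ?_⟩
  rw [sum_univ_eq_add_cyclic _ j, sum_univ_eq_add_cyclic _ j, coord_neighbor_self,
    coord_neighbor_of_ne (by simp), coord_neighbor_of_ne (by simp)]
  rcases sgn_eq_one_or_neg_one f with hf | hf <;> rw [hf] at hj ⊢ <;> omega

theorem isPolyiamond_region {a b : Fin 3 → ℤ} (h : (region a b).Nonempty) :
    IsPolyiamond (region a b) := by
  have h_reach {f g : Face} (hf : f ∈ region a b) (hg : g ∈ region a b) :
      (faceGraph.induce (region a b : Set Face)).Reachable ⟨f, hf⟩ ⟨g, hg⟩ := by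
    induction hn : ∑ k, (coord g k - coord f k).natAbs using Nat.strong_induction_on
      generalizing f with
    | _ n ih =>
      rcases eq_or_ne f g with rfl | hne
      · rfl
      obtain ⟨j, h_ge, h_le, h_lt⟩ := exists_neighbor_closer hne
      have hf' : neighbor j f ∈ region a b := by
        rw [mem_region] at hf hg ⊢
        intro k
        rcases eq_or_ne k j with rfl | hk
        · have := hf k
          have := hg k
          omega
        · rw [coord_neighbor_of_ne hk]
          exact hf k
      have h_adj : (faceGraph.induce (region a b : Set Face)).Adj ⟨f, hf⟩ ⟨_, hf'⟩ :=
        neighbor_adj j f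
      exact h_adj.reachable.trans (ih _ (hn ▸ h_lt) hf' rfl)
  obtain ⟨f, hf⟩ := h
  exact SimpleGraph.connected_iff_exists_forall_reachable _ |>.2
    ⟨⟨f, hf⟩, fun g => h_reach hf g.2⟩

theorem IsPolyiamond.exists_coord_eq {P : Finset Face} (hP : IsPolyiamond P) {f g : Face}
    (hf : f ∈ P) (hg : g ∈ P) {j : Fin 3} {c : ℤ} (hfc : coord f j ≤ c) (hcg : c ≤ coord g j) :
    ∃ h ∈ P, coord h j = c := by
  rcases hfc.eq_or_lt with rfl | hfc
  · exact ⟨f, hf, rfl⟩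
  obtain ⟨w⟩ := hP.preconnected ⟨f, hf⟩ ⟨g, hg⟩
  obtain ⟨d, -, h_fst, h_snd⟩ :=
    w.exists_boundary_dart {h | coord h.1 j < c} hfc (not_lt.2 hcg)
  refine ⟨d.snd, d.snd.2, ?_⟩
  obtain ⟨k, hk : d.snd.1 = neighbor k d.fst.1⟩ := adj_iff_exists_eq_neighbor.1 d.adj
  simp only [Set.mem_ofPred_eq, not_lt] at h_fst h_snd
  rw [hk, coord_neighbor, Pi.add_apply, Pi.single_apply] at h_snd ⊢
  rcases sgn_eq_one_or_neg_one d.fst.1 with hd | hd <;> rw [hd] at h_snd ⊢ <;> split_ifs at * <;>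
    omega

end Connectedness

section SitePerimeter

/-- The faces counted by the site-perimeter of `P`. -/
noncomputable def sites (P : Finset Face) : Finset Face :=
  (Finset.univ.biUnion fun j => P.image (neighbor j)) \ P

/-- The sites of `P` that share exactly one of their two edges transversal to their row in
direction `j` with `P`; the row of a face in direction `j` is the strip of all faces with the same
coordinate `j`. -/
noncomputable def rowEnds (j : Fin 3) (P : Finset Face) : Finset Face :=
  {g ∈ sites P | ¬(neighbor (j + 1) g ∈ P ↔ neighbor (j + 2) g ∈ P)}

theorem mem_sites {P : Finset Face} {g : Face} :
    g ∈ sites P ↔ (∃ j, neighbor j g ∈ P) ∧ g ∉ P := by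
  simp only [sites, Finset.mem_sdiff, Finset.mem_biUnion, Finset.mem_univ, true_and,
    Finset.mem_image]
  refine and_congr_left fun _ => exists_congr fun j => ⟨?_, fun h => ⟨_, h, neighbor_neighbor j g⟩⟩
  rintro ⟨f, hf, rfl⟩
  rwa [neighbor_neighbor]

theorem sitePerimeter_eq_card_sites (P : Finset Face) : sitePerimeter P = (sites P).card := by
  rw [sitePerimeter, ← Set.ncard_coe_finset]
  congr 1
  ext g
  rw [Set.mem_ofPred_eq, Finset.mem_coe, mem_sites, and_comm]
  simp only [adj_iff_exists_eq_neighbor]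
  grind

/-- The position of a face within its row in direction `j`. -/
def rowPosition (j : Fin 3) (f : Face) : ℤ := coord f (j + 1) - coord f (j + 2)

theorem exists_rowPosition_neighbor_eq (j : Fin 3) (f : Face) {σ : ℤ} (hσ : σ = 1 ∨ σ = -1) :
    ∃ k k', (k = j + 1 ∧ k' = j + 2 ∨ k = j + 2 ∧ k' = j + 1) ∧
      rowPosition j (neighbor k f) = rowPosition j f + σ ∧
      rowPosition j (neighbor k' (neighbor k f)) = rowPosition j f + 2 * σ := by
  have h_add_one (f : Face) : rowPosition j (neighbor (j + 1) f) = rowPosition j f + sgn f := by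
    rw [rowPosition, rowPosition, coord_neighbor_self, coord_neighbor_of_ne (by simp)]
    ring
  have h_add_two (f : Face) : rowPosition j (neighbor (j + 2) f) = rowPosition j f - sgn f := by
    rw [rowPosition, rowPosition, coord_neighbor_self, coord_neighbor_of_ne (by simp)]
    ring
  have h_sgn : sgn f = σ ∨ sgn f = -σ := by
    rcases sgn_eq_one_or_neg_one f with h | h <;> omega
  rcases h_sgn with h_sgn | h_sgn
  · refine ⟨j + 1, j + 2, by simp, ?_, ?_⟩ <;> simp only [h_add_one, h_add_two, sgn_neighbor] <;>
      omega
  · refine ⟨j + 2, j + 1, by simp, ?_, ?_⟩ <;> simp only [h_add_one, h_add_two, sgn_neighbor] <;>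
      omega

theorem coord_eq_of_mem_rowEnds {j : Fin 3} {P : Finset Face} {g : Face} (hg : g ∈ rowEnds j P) :
    coord g j ∈ P.image fun f => coord f j := by
  have h_transversal : neighbor (j + 1) g ∈ P ∨ neighbor (j + 2) g ∈ P := by
    have := (Finset.mem_filter.1 hg).2
    tauto
  rw [Finset.mem_image]
  rcases h_transversal with h | h <;> exact ⟨_, h, coord_neighbor_of_ne (by simp) g⟩

theorem exists_mem_rowEnds {P : Finset Face} {f : Face} (hf : f ∈ P) (j : Fin 3) {σ : ℤ}
    (hσ : σ = 1 ∨ σ = -1) : ∃ g ∈ rowEnds j P, coord g j = coord f j ∧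
      0 < σ * (rowPosition j g - rowPosition j f) := by
  obtain ⟨e, he, h_max⟩ := Finset.exists_max_image {e ∈ P | coord e j = coord f j}
    (fun e => σ * rowPosition j e) ⟨f, Finset.mem_filter.2 ⟨hf, rfl⟩⟩
  simp only [Finset.mem_filter, and_imp] at he h_max
  have h_notMem {g : Face} (h_row : coord g j = coord f j)
      (h_lt : σ * rowPosition j e < σ * rowPosition j g) : g ∉ P :=
    fun hg => (h_max g hg h_row).not_gt h_lt
  obtain ⟨k, k', hk, h_step, h_step'⟩ := exists_rowPosition_neighbor_eq j e hσ
  have hk_ne : j ≠ k ∧ j ≠ k' := by rcases hk with ⟨rfl, rfl⟩ | ⟨rfl, rfl⟩ <;> simp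
  have h_row : coord (neighbor k e) j = coord f j := by rw [coord_neighbor_of_ne hk_ne.1, he.2]
  have h_site : neighbor k e ∉ P := h_notMem h_row (by rw [h_step]; grind)
  have h_next : neighbor k' (neighbor k e) ∉ P :=
    h_notMem (by rw [coord_neighbor_of_ne hk_ne.2, h_row]) (by rw [h_step']; grind)
  have h_back : neighbor k (neighbor k e) ∈ P := (neighbor_neighbor k e).symm ▸ he.1
  refine ⟨neighbor k e, ?_, h_row, ?_⟩
  · rw [rowEnds, Finset.mem_filter, mem_sites]
    refine ⟨⟨⟨k, h_back⟩, h_site⟩, ?_⟩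
    rcases hk with ⟨rfl, rfl⟩ | ⟨rfl, rfl⟩ <;> tauto
  · have := h_max f hf rfl
    rw [h_step]
    grind

theorem two_mul_card_rows_le_card_rowEnds (j : Fin 3) (P : Finset Face) :
    2 * (P.image fun f => coord f j).card ≤ (rowEnds j P).card := by
  refine Finset.mul_card_image_le_card_of_maps_to (f := fun g => coord g j)
    (fun g hg => coord_eq_of_mem_rowEnds hg) 2 fun c hc => ?_
  obtain ⟨f, hf, rfl⟩ := Finset.mem_image.1 hc
  obtain ⟨g, hg, hgf, h_pos⟩ := exists_mem_rowEnds hf j (σ := 1) (by simp)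
  obtain ⟨g', hg', hgf', h_neg⟩ := exists_mem_rowEnds hf j (σ := -1) (by simp)
  refine Finset.one_lt_card.2 ⟨g, by simp [hg, hgf], g', by simp [hg', hgf'], ?_⟩
  rintro rfl
  omega

theorem sum_card_rowEnds_le (P : Finset Face) :
    ∑ j, (rowEnds j P).card ≤ 2 * (sites P).card := by
  simp only [rowEnds, Finset.card_filter]
  rw [Finset.sum_comm, mul_comm, ← smul_eq_mul, ← Finset.sum_const]
  refine Finset.sum_le_sum fun g _ => ?_
  rw [Fin.sum_univ_three]
  simp only [Fin.isValue, Fin.reduceAdd, zero_add]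
  split_ifs <;> first | omega | tauto

theorem sum_card_rows_le_sitePerimeter (P : Finset Face) :
    ∑ j, (P.image fun f => coord f j).card ≤ sitePerimeter P := by
  have h := (Finset.sum_le_sum fun j _ => two_mul_card_rows_le_card_rowEnds j P).trans
    (sum_card_rowEnds_le P)
  rw [← Finset.mul_sum] at h
  rw [sitePerimeter_eq_card_sites]
  omega

end SitePerimeter

section TightRegions

/-- The length of the side of `region a b` on the line `p j = a j`, provided that no side is
degenerate. -/
def lowerSide (a b : Fin 3 → ℤ) (j : Fin 3) : ℤ := a j + b (j + 1) + b (j + 2)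

/-- The length of the side of `region a b` on the line `p j = b j`, provided that no side is
degenerate. -/
def upperSide (a b : Fin 3 → ℤ) (j : Fin 3) : ℤ := -(b j + a (j + 1) + a (j + 2))

/-- All six lines bounding `region a b` contain a (possibly degenerate) side of it. -/
def IsTight (a b : Fin 3 → ℤ) : Prop := ∀ j, 0 ≤ lowerSide a b j ∧ 0 ≤ upperSide a b j

theorem two_mul_coord_add_cyclic (f : Face) (j : Fin 3) :
    2 * (coord f j + coord f (j + 1) + coord f (j + 2)) = -3 - sgn f := by
  rw [← sum_univ_eq_add_cyclic, two_mul_sum_coord]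

theorem card_le_of_forall_coord_mem_Ico {s : Finset Face} {j : Fin 3} {c σ m n : ℤ} (hmn : m ≤ n)
    (h : ∀ f ∈ s, sgn f = σ ∧ coord f j = c ∧ coord f (j + 1) ∈ Finset.Ico m n) :
    (s.card : ℤ) ≤ n - m := by
  have h_inj : Set.InjOn (fun f => coord f (j + 1)) s := fun f hf g hg hfg => by
    refine coord_injective (funext ((forall_fin_three_cyclic j).2 ?_))
    have := two_mul_coord_add_cyclic f j
    have := two_mul_coord_add_cyclic g j
    have := h f hf
    have := h g hg
    simp only at hfg
    omega
  have := Finset.card_le_card_of_injOn _ (fun f hf => (h f hf).2.2) h_inj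
  rw [Int.card_Ico] at this
  omega

theorem sgn_coord_of_mem_sites_region {a b : Fin 3 → ℤ} {g : Face}
    (hg : g ∈ sites (region a b)) :
    ∃ j, (sgn g = 1 ∧ coord g j = a j - 1 ∧
        coord g (j + 1) ∈ Finset.Ico (-a j - b (j + 2)) (b (j + 1))) ∨
      sgn g = -1 ∧ coord g j = b j ∧
        coord g (j + 1) ∈ Finset.Ico (a (j + 1)) (-b j - a (j + 2)) := by
  obtain ⟨⟨j, hj⟩, h_notMem⟩ := mem_sites.1 hg
  refine ⟨j, ?_⟩
  simp only [mem_region, forall_fin_three_cyclic j, coord_neighbor_self,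
    coord_neighbor_of_ne (show j + 1 ≠ j by simp), coord_neighbor_of_ne (show j + 2 ≠ j by simp)]
    at hj h_notMem
  have := two_mul_coord_add_cyclic g j
  simp only [Finset.mem_Ico]
  rcases sgn_eq_one_or_neg_one g with h | h <;> omega

theorem sitePerimeter_region_le {a b : Fin 3 → ℤ} (h : IsTight a b) :
    (sitePerimeter (region a b) : ℤ) ≤ ∑ j, (b j - a j) := by
  let lower (j : Fin 3) : Finset Face := {g ∈ sites (region a b) | sgn g = 1 ∧
    coord g j = a j - 1 ∧ coord g (j + 1) ∈ Finset.Ico (-a j - b (j + 2)) (b (j + 1))}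
  let upper (j : Fin 3) : Finset Face := {g ∈ sites (region a b) | sgn g = -1 ∧
    coord g j = b j ∧ coord g (j + 1) ∈ Finset.Ico (a (j + 1)) (-b j - a (j + 2))}
  have h_lower (j : Fin 3) : ((lower j).card : ℤ) ≤ lowerSide a b j := by
    have := (h j).1
    unfold lowerSide at *
    have := card_le_of_forall_coord_mem_Ico (s := lower j) (by omega)
      fun g hg => (Finset.mem_filter.1 hg).2
    omega
  have h_upper (j : Fin 3) : ((upper j).card : ℤ) ≤ upperSide a b j := by
    have := (h j).2
    unfold upperSide at *
    have := card_le_of_forall_coord_mem_Ico (s := upper j) (by omega)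
      fun g hg => (Finset.mem_filter.1 hg).2
    omega
  have h_cover : sites (region a b) ⊆ Finset.univ.biUnion fun j => lower j ∪ upper j := by
    intro g hg
    obtain ⟨j, hj⟩ := sgn_coord_of_mem_sites_region hg
    simp only [Finset.mem_biUnion, Finset.mem_union, Finset.mem_filter, lower, upper]
    exact ⟨j, Finset.mem_univ j, hj.imp (⟨hg, ·⟩) (⟨hg, ·⟩)⟩
  calc (sitePerimeter (region a b) : ℤ)
      ≤ ∑ j, (((lower j).card : ℤ) + (upper j).card) := by
        rw [sitePerimeter_eq_card_sites]
        exact_mod_cast (Finset.card_le_card h_cover).trans <| Finset.card_biUnion_le.trans <|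
          Finset.sum_le_sum fun j _ => Finset.card_union_le _ _
    _ ≤ ∑ j, (lowerSide a b j + upperSide a b j) :=
        Finset.sum_le_sum fun j _ => add_le_add (h_lower j) (h_upper j)
    _ = ∑ j, (b j - a j) := by
        simp only [Fin.sum_univ_three, lowerSide, upperSide, Fin.reduceAdd, zero_add]
        ring

theorem card_triangle (n : ℕ) : (triangle n).card = n ^ 2 := by
  -- Upward faces fill one half of a square, cut along its diagonal, and downward faces the other.
  let toSquare (f : Face) : ℤ × ℤ :=
    if f.2.2 then (f.1, f.1 + f.2.1) else (f.1 + f.2.1 + 1, f.1)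
  let ofSquare (p : ℤ × ℤ) : Face :=
    if p.1 ≤ p.2 then (p.1, p.2 - p.1, true) else (p.2, p.1 - p.2 - 1, false)
  have h_card : (triangle n).card = (Finset.Ico (0 : ℤ) n ×ˢ Finset.Ico (0 : ℤ) n).card := by
    rw [triangle_eq_region]
    refine Finset.card_nbij' toSquare ofSquare ?_ ?_ ?_ ?_
    · rintro ⟨x, y, _ | _⟩ h <;> simp [mem_region_iff, coord, toSquare] at h ⊢ <;> omega
    · rintro ⟨i, j⟩ h
      simp only [ofSquare]
      split_ifs <;> simp [mem_region_iff, coord] at h ⊢ <;> omega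
    · rintro ⟨x, y, _ | _⟩ h <;> simp [mem_region_iff, coord, toSquare, ofSquare] at h ⊢ <;> grind
    · rintro ⟨i, j⟩ -
      simp only [ofSquare]
      split_ifs <;> simp [toSquare, *]
      omega
  rw [h_card, Finset.card_product, Int.card_Ico, sub_zero, Int.toNat_natCast, sq]

/-- The faces above the three lines `p j = a j`: they form an upward triangle. -/
noncomputable def upTriangle (a : Fin 3 → ℤ) : Finset Face :=
  region a fun j => -(a (j + 1) + a (j + 2))

theorem mem_upTriangle {a : Fin 3 → ℤ} {f : Face} : f ∈ upTriangle a ↔ ∀ j, a j ≤ coord f j := by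
  rw [upTriangle, mem_region, forall_and, and_iff_left_iff_imp]
  intro h j
  have := two_mul_coord_add_cyclic f j
  have := h (j + 1)
  have := h (j + 2)
  rcases sgn_eq_one_or_neg_one f <;> omega

theorem card_upTriangle {a : Fin 3 → ℤ} (h : ∑ j, a j ≤ 0) :
    ((upTriangle a).card : ℤ) = (∑ j, a j) ^ 2 := by
  have h_image : upTriangle a = (triangle (-∑ j, a j).toNat).image (translate (a 0, a 1)) := by
    rw [triangle_eq_region, region_image_translate]
    rw [Fin.sum_univ_three] at h ⊢
    ext f
    simp [upTriangle, mem_region, Fin.forall_fin_succ]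
    omega
  have h_inj : Function.Injective (translate (a 0, a 1)) := move_injective 0 _
  rw [h_image, Finset.card_image_of_injective _ h_inj, card_triangle]
  push_cast
  rw [Int.toNat_of_nonneg (by omega), neg_sq]

theorem IsTight.le {a b : Fin 3 → ℤ} (h : IsTight a b) (j : Fin 3) : a j ≤ b j := by
  have h₁ := (h (j + 1)).1
  have h₂ := (h (j + 2)).2
  simp only [lowerSide, upperSide, add_assoc, Fin.reduceAdd, add_zero] at h₁ h₂
  omega

theorem upTriangle_eq_region_union {a b : Fin 3 → ℤ} (h : IsTight a b) : upTriangle a =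
    region a b ∪ Finset.univ.biUnion fun j => upTriangle (Function.update a j (b j)) := by
  ext f
  simp only [mem_upTriangle, Finset.mem_union, mem_region, Finset.mem_biUnion, Finset.mem_univ,
    true_and, Function.update_apply]
  constructor
  · intro hf
    by_contra! h_not
    obtain ⟨⟨j, hj⟩, h_corner⟩ := h_not
    obtain ⟨k, hk⟩ := h_corner j
    grind
  · rintro (hf | ⟨j, hf⟩) k
    · exact (hf k).1
    · have := h.le k
      have := hf k
      grind

theorem disjoint_upTriangle_update {a b : Fin 3 → ℤ} (h : IsTight a b) {j k : Fin 3} (hjk : j ≠ k) :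
    Disjoint (upTriangle (Function.update a j (b j))) (upTriangle (Function.update a k (b k))) := by
  have exists_third : ∀ j k : Fin 3, j ≠ k →
      ∃ l, (l + 1 = j ∧ l + 2 = k) ∨ l + 1 = k ∧ l + 2 = j := by decide
  refine Finset.disjoint_left.2 fun f hj hk => ?_
  rw [mem_upTriangle] at hj hk
  obtain ⟨l, ⟨rfl, rfl⟩ | ⟨rfl, rfl⟩⟩ := exists_third j k hjk <;>
  · have := two_mul_coord_add_cyclic f l
    have := (h l).1
    have := hj l
    have := hj (l + 1)
    have := hj (l + 2)
    have := hk (l + 1)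
    have := hk (l + 2)
    rcases sgn_eq_one_or_neg_one f <;> simp [lowerSide] at * <;> omega

theorem card_region {a b : Fin 3 → ℤ} (h : IsTight a b) :
    ((region a b).card : ℤ) = (∑ j, a j) ^ 2 - ∑ j, upperSide a b j ^ 2 := by
  let corner (j : Fin 3) : Finset Face := upTriangle (Function.update a j (b j))
  have h_corner_sum (j : Fin 3) : ∑ k, Function.update a j (b j) k = -upperSide a b j := by
    rw [sum_univ_eq_add_cyclic _ j]
    simp [upperSide]
  have h_corner_card (j : Fin 3) : ((corner j).card : ℤ) = upperSide a b j ^ 2 := by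
    rw [card_upTriangle (by rw [h_corner_sum]; linarith [(h j).2]), h_corner_sum, neg_sq]
  have h_sum : ∑ j, a j ≤ 0 := by
    have := (h 0).2
    have := h.le 0
    simp [upperSide, Fin.sum_univ_three] at *
    omega
  have h_corners : Set.PairwiseDisjoint (Finset.univ : Finset (Fin 3)) corner :=
    fun _ _ _ _ => disjoint_upTriangle_update h
  have h_disj : Disjoint (region a b) (Finset.univ.biUnion corner) := by
    refine (Finset.disjoint_biUnion_right ..).2 fun j _ => Finset.disjoint_left.2 fun f hf hj => ?_
    have h_lt := (mem_region.1 hf j).2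
    have h_le := mem_upTriangle.1 hj j
    rw [Function.update_self] at h_le
    exact h_le.not_gt h_lt
  have h_card := card_upTriangle h_sum
  rw [upTriangle_eq_region_union h, Finset.card_union_of_disjoint h_disj,
    Finset.card_biUnion h_corners] at h_card
  push_cast [h_corner_card] at h_card
  linarith

end TightRegions

section BoundingRegion

theorem IsPolyiamond.exists_subset_region {P : Finset Face} (hP : IsPolyiamond P) :
    ∃ a b, IsTight a b ∧ P ⊆ region a b ∧ ∑ j, (b j - a j) ≤ sitePerimeter P := by
  choose lo lo_mem lo_le using fun j : Fin 3 => P.exists_min_image (coord · j) hP.nonempty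
  choose hi hi_mem le_hi using fun j : Fin 3 => P.exists_max_image (coord · j) hP.nonempty
  refine ⟨fun j => coord (lo j) j, fun j => coord (hi j) j + 1, fun j => ?_, fun f hf => ?_, ?_⟩
  · have := two_mul_coord_add_cyclic (lo j) j
    have := two_mul_coord_add_cyclic (hi j) j
    have := le_hi (j + 1) _ (lo_mem j)
    have := le_hi (j + 2) _ (lo_mem j)
    have := lo_le (j + 1) _ (hi_mem j)
    have := lo_le (j + 2) _ (hi_mem j)
    rcases sgn_eq_one_or_neg_one (lo j) <;> rcases sgn_eq_one_or_neg_one (hi j) <;>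
      simp only [lowerSide, upperSide] <;> omega
  · exact mem_region.2 fun j => ⟨lo_le j f hf, Int.lt_add_one_of_le (le_hi j f hf)⟩
  · have h_rows (j : Fin 3) :
        Finset.Icc (coord (lo j) j) (coord (hi j) j) ⊆ P.image fun f => coord f j := by
      intro c hc
      rw [Finset.mem_Icc] at hc
      exact Finset.mem_image.2 (hP.exists_coord_eq (lo_mem j) (hi_mem j) hc.1 hc.2)
    refine le_trans (Finset.sum_le_sum fun j _ => ?_)
      (Nat.cast_le.2 (sum_card_rows_le_sitePerimeter P) |>.trans' (Nat.cast_sum _ _).ge)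
    have h_card := Finset.card_le_card (h_rows j)
    rw [Int.card_Icc] at h_card
    dsimp only
    omega

end BoundingRegion

section MaximalArea

/-- Widths that differ by at most one, and opposite bounding lines placed as symmetrically as
possible: the shape of the regions of maximal area. -/
structure IsBalanced (a b : Fin 3 → ℤ) : Prop where
  width_le : ∀ j k, b j - a j ≤ b k - a k + 1
  abs_sum_le : |∑ j, (a j + b j)| ≤ 1

/-- Twice the largest area of a polyiamond of site-perimeter `s`. Subject to `∑ w j = s`, the
minimum of `∑ w j ^ 2` is `(2 * m + 1) * s - 3 * m * (m + 1)` with `m = s / 3`, attained when every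
`w j` is `m` or `m + 1`. -/
def twiceMaxArea (s : ℤ) : ℤ :=
  s ^ 2 - 2 * ((2 * (s / 3) + 1) * s - 3 * (s / 3) * (s / 3 + 1)) - s % 2

theorem two_mul_card_region {a b : Fin 3 → ℤ} (h : IsTight a b) :
    2 * ((region a b).card : ℤ) = (∑ j, (b j - a j)) ^ 2 - 2 * ∑ j, (b j - a j) ^ 2 -
      (∑ j, (a j + b j)) ^ 2 := by
  rw [card_region h]
  simp [Fin.sum_univ_three, upperSide]
  ring

theorem linear_le_sq (m w : ℤ) : (2 * m + 1) * w - m * (m + 1) ≤ w ^ 2 := by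
  rcases le_or_gt w m with h | h <;> nlinarith

theorem linear_eq_sq_iff {m w : ℤ} :
    (2 * m + 1) * w - m * (m + 1) = w ^ 2 ↔ w = m ∨ w = m + 1 := by
  rw [← sub_eq_zero (a := w), ← sub_eq_zero (a := w) (b := m + 1), ← mul_eq_zero]
  constructor <;> intro h <;> linarith

theorem emod_two_le_sq (n : ℤ) : n % 2 ≤ n ^ 2 := by
  rcases eq_or_ne n 0 with rfl | h
  · rfl
  · have := Int.emod_two_eq n
    have := sq_pos_of_ne_zero h
    omega

theorem emod_two_eq_sq_iff {n : ℤ} : n % 2 = n ^ 2 ↔ |n| ≤ 1 := by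
  constructor
  · intro h
    rw [← sq_le_one_iff_abs_le_one, ← h]
    omega
  · intro h
    obtain ⟨h₁, h₂⟩ := abs_le.1 h
    interval_cases n <;> rfl

theorem sum_add_emod_two (a b : Fin 3 → ℤ) :
    (∑ j, (a j + b j)) % 2 = (∑ j, (b j - a j)) % 2 := by
  simp only [Fin.sum_univ_three]
  omega

theorem twiceMaxArea_sum (w : Fin 3 → ℤ) (m : ℤ) (hm : m = (∑ j, w j) / 3) :
    twiceMaxArea (∑ j, w j) = (∑ j, w j) ^ 2 -
      2 * ∑ j, ((2 * m + 1) * w j - m * (m + 1)) - (∑ j, w j) % 2 := by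
  rw [twiceMaxArea, Finset.sum_sub_distrib, ← Finset.mul_sum, ← hm]
  simp
  ring

theorem two_mul_card_region_le {a b : Fin 3 → ℤ} (h : IsTight a b) :
    2 * ((region a b).card : ℤ) ≤ twiceMaxArea (∑ j, (b j - a j)) := by
  have h_sq := Finset.sum_le_sum fun j (_ : j ∈ Finset.univ) =>
    linear_le_sq ((∑ j, (b j - a j)) / 3) (b j - a j)
  have h_parity := emod_two_le_sq (∑ j, (a j + b j))
  rw [sum_add_emod_two] at h_parity
  rw [two_mul_card_region h, twiceMaxArea_sum _ _ rfl]
  linarith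

theorem isBalanced_iff {a b : Fin 3 → ℤ} : IsBalanced a b ↔
    (∀ j, b j - a j = (∑ j, (b j - a j)) / 3 ∨ b j - a j = (∑ j, (b j - a j)) / 3 + 1) ∧
      |∑ j, (a j + b j)| ≤ 1 := by
  constructor
  · rintro ⟨h_width, h_abs⟩
    refine ⟨fun j => ?_, h_abs⟩
    have := h_width j
    have := fun k => h_width k j
    rw [sum_univ_eq_add_cyclic _ j]
    simp only [forall_fin_three_cyclic j] at *
    omega
  · rintro ⟨h_width, h_abs⟩
    refine ⟨fun j k => ?_, h_abs⟩
    have := h_width j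
    have := h_width k
    omega

theorem two_mul_card_region_eq_iff {a b : Fin 3 → ℤ} (h : IsTight a b) :
    2 * ((region a b).card : ℤ) = twiceMaxArea (∑ j, (b j - a j)) ↔ IsBalanced a b := by
  have h_sq := fun j (_ : j ∈ Finset.univ) =>
    linear_le_sq ((∑ j, (b j - a j)) / 3) (b j - a j)
  have h_sum_sq := Finset.sum_le_sum h_sq
  have h_sum_sq_iff := Finset.sum_eq_sum_iff_of_le h_sq
  have h_parity := emod_two_le_sq (∑ j, (a j + b j))
  have h_parity_iff := emod_two_eq_sq_iff (n := ∑ j, (a j + b j))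
  rw [sum_add_emod_two] at h_parity h_parity_iff
  rw [two_mul_card_region h, twiceMaxArea_sum _ _ rfl, isBalanced_iff, ← h_parity_iff]
  simp only [Finset.mem_univ, forall_const, linear_eq_sq_iff] at h_sum_sq_iff
  rw [← h_sum_sq_iff]
  constructor
  · intro h_eq
    constructor <;> linarith
  · rintro ⟨h₁, h₂⟩
    linarith

theorem twiceMaxArea_lt_add_one {s : ℤ} (hs : 2 ≤ s) : twiceMaxArea s < twiceMaxArea (s + 1) := by
  have h_parity : (s + 1) % 2 = 1 - s % 2 := by omega
  have h_parity_le := Int.emod_two_eq s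
  have h_three : (s = 3 * (s / 3) ∧ (s + 1) / 3 = s / 3) ∨
      (s = 3 * (s / 3) + 1 ∧ (s + 1) / 3 = s / 3) ∨
      s = 3 * (s / 3) + 2 ∧ (s + 1) / 3 = s / 3 + 1 := by omega
  have h_pos : 0 < 2 * (s / 3) - 2 + 2 * (s % 2) ∨ s % 3 ≠ 0 := by omega
  simp only [twiceMaxArea, h_parity]
  generalize s % 2 = p, s / 3 = m at *
  rcases h_three with ⟨rfl, h⟩ | ⟨rfl, h⟩ | ⟨rfl, h⟩ <;> rw [h]
  · have : 0 < 2 * m - 2 + 2 * p := by omega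
    linarith
  · have : 0 < 2 * m + 2 * p := by omega
    linarith
  · have : 0 < 2 * m + 2 + 2 * p := by omega
    linarith

theorem twiceMaxArea_lt {s t : ℤ} (hs : 2 ≤ s) (hst : s < t) : twiceMaxArea s < twiceMaxArea t := by
  induction t, hst using Int.leInduction with
  | base => exact twiceMaxArea_lt_add_one hs
  | succ t ht ih => exact ih.trans (twiceMaxArea_lt_add_one (by omega))

end MaximalArea

section Maximizers

theorem IsBalanced.isTight {a b : Fin 3 → ℤ} (h : IsBalanced a b) (hs : 3 ≤ ∑ j, (b j - a j)) :
    IsTight a b := by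
  intro j
  have h_width := h.width_le j
  have h_abs := abs_le.1 h.abs_sum_le
  have h_width' := fun k => h.width_le k j
  simp only [forall_fin_three_cyclic j, sum_univ_eq_add_cyclic _ j, lowerSide, upperSide] at *
  omega

/-- The hexagonal regions with balanced bounding lines, parametrized by the sum `s` of the three
widths, which for `3 ≤ s` is the site-perimeter. -/
def IsBalancedRegion (s : ℤ) (P : Finset Face) : Prop :=
  ∃ a b, IsBalanced a b ∧ ∑ j, (b j - a j) = s ∧ P = region a b

theorem IsBalancedRegion.two_mul_card {s : ℤ} {P : Finset Face} (h : IsBalancedRegion s P)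
    (hs : 3 ≤ s) : 2 * (P.card : ℤ) = twiceMaxArea s := by
  obtain ⟨a, b, h_balanced, rfl, rfl⟩ := h
  exact (two_mul_card_region_eq_iff (h_balanced.isTight hs)).2 h_balanced

theorem IsBalancedRegion.isPolyiamond {s : ℤ} {P : Finset Face} (h : IsBalancedRegion s P)
    (hs : 3 ≤ s) : IsPolyiamond P := by
  have h_pos : twiceMaxArea 2 < twiceMaxArea s := twiceMaxArea_lt le_rfl hs
  rw [← h.two_mul_card hs] at h_pos
  obtain ⟨a, b, -, -, rfl⟩ := h
  refine isPolyiamond_region (Finset.card_pos.1 ?_)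
  have : twiceMaxArea 2 = 0 := rfl
  omega

theorem three_le_sum_of_region_nonempty {a b : Fin 3 → ℤ} (h : (region a b).Nonempty) :
    3 ≤ ∑ j, (b j - a j) := by
  obtain ⟨f, hf⟩ := h
  have h_lt (j : Fin 3) : 1 ≤ b j - a j := by
    have := mem_region.1 hf j
    omega
  simpa using Finset.sum_le_sum fun j (_ : j ∈ Finset.univ) => h_lt j

theorem IsPolyiamond.three_le_sitePerimeter {P : Finset Face} (hP : IsPolyiamond P) :
    3 ≤ (sitePerimeter P : ℤ) := by
  obtain ⟨a, b, -, h_subset, h_sum⟩ := hP.exists_subset_region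
  exact (three_le_sum_of_region_nonempty (hP.nonempty.mono h_subset)).trans h_sum

theorem IsPolyiamond.isBalancedRegion_of_le {P : Finset Face} (hP : IsPolyiamond P)
    (h : twiceMaxArea (sitePerimeter P) ≤ 2 * P.card) : IsBalancedRegion (sitePerimeter P) P := by
  obtain ⟨a, b, h_tight, h_subset, h_sum⟩ := hP.exists_subset_region
  have h_three := three_le_sum_of_region_nonempty (hP.nonempty.mono h_subset)
  have h_card_le := Finset.card_le_card h_subset
  have h_area := two_mul_card_region_le h_tight
  have h_sum_eq : ∑ j, (b j - a j) = sitePerimeter P := by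
    refine h_sum.eq_of_not_lt fun h_lt => ?_
    have := twiceMaxArea_lt (by omega) h_lt
    omega
  refine ⟨a, b, (two_mul_card_region_eq_iff h_tight).1 (h_area.antisymm ?_), h_sum_eq,
    Finset.eq_of_subset_of_card_le h_subset ?_⟩
  · rw [h_sum_eq]
    omega
  · rw [h_sum_eq] at h_area
    omega

theorem IsPolyiamond.two_mul_card_le {P : Finset Face} (hP : IsPolyiamond P) :
    2 * (P.card : ℤ) ≤ twiceMaxArea (sitePerimeter P) := by
  by_contra! h
  have h_balanced := hP.isBalancedRegion_of_le h.le
  exact h.ne' (h_balanced.two_mul_card hP.three_le_sitePerimeter)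

theorem IsBalancedRegion.sitePerimeter_eq {s : ℤ} {P : Finset Face} (h : IsBalancedRegion s P)
    (hs : 3 ≤ s) : (sitePerimeter P : ℤ) = s := by
  have hP := h.isPolyiamond hs
  have h_ge : ¬(sitePerimeter P : ℤ) < s := fun h_lt => by
    have h_area_lt := twiceMaxArea_lt (by have := hP.three_le_sitePerimeter; omega) h_lt
    exact (h_area_lt.trans_eq (h.two_mul_card hs).symm).not_ge hP.two_mul_card_le
  obtain ⟨a, b, h_balanced, rfl, rfl⟩ := h
  exact (sitePerimeter_region_le (h_balanced.isTight hs)).eq_of_not_lt h_ge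

/-- The balanced region used as representative, with widths `s / 3`, `(s + 2) / 3` and
`(s + 1) / 3`. Its top row lies above the axis `p 1 = 0`. -/
noncomputable def standardRegion (s : ℤ) : Finset Face :=
  region ![0, 1 - (s + 2) / 3, (s + 2) / 3 - s / 2 - 1] ![s / 3, 1, (s + 1) / 2 - s / 3 - 1]

theorem isBalancedRegion_standardRegion (s : ℤ) : IsBalancedRegion s (standardRegion s) := by
  refine ⟨_, _, ⟨?_, ?_⟩, ?_, rfl⟩
  · simp [Fin.forall_fin_succ]
    omega
  · simp [Fin.sum_univ_three, abs_le]
    omega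
  · simp [Fin.sum_univ_three]
    omega

theorem isAreaMaximizer_iff {s : ℕ} (hs : 3 ≤ s) {P : Finset Face} :
    IsAreaMaximizer s P ↔ IsBalancedRegion s P := by
  have hs' : (3 : ℤ) ≤ s := by exact_mod_cast hs
  constructor
  · rintro ⟨hP, rfl, h_max⟩
    have h := isBalancedRegion_standardRegion (sitePerimeter P)
    have h_le := h_max _ (h.isPolyiamond hs') (Nat.cast_injective (h.sitePerimeter_eq hs'))
    refine hP.isBalancedRegion_of_le ?_
    rw [← h.two_mul_card hs']
    omega
  · intro h
    refine ⟨h.isPolyiamond hs', Nat.cast_injective (h.sitePerimeter_eq hs'), ?_⟩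
    rintro Q hQ rfl
    have := hQ.two_mul_card_le
    rw [← h.two_mul_card hs'] at this
    omega

end Maximizers

section NormalForm

theorem latticeCongruent_region_rotate (a b : Fin 3 → ℤ) :
    LatticeCongruent (region a b) (region (fun j => -b (j + 1)) fun j => -a (j + 1)) :=
  ⟨1, 0, (region_image_rotate a b).symm.trans (congrArg (Finset.image · _) (funext fun f => by
    simp [move, translate]))⟩

theorem latticeCongruent_region_shift (a b : Fin 3 → ℤ) (i : Fin 3) :
    LatticeCongruent (region a b) (region (fun j => a (j + i)) fun j => b (j + i)) := by
  have shift_two (a b : Fin 3 → ℤ) :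
      LatticeCongruent (region a b) (region (fun j => a (j + 2)) fun j => b (j + 2)) := by
    simpa [add_assoc] using
      (latticeCongruent_region_rotate a b).trans (latticeCongruent_region_rotate _ _)
  fin_cases i
  · simpa [add_assoc] using ((shift_two a b).trans (shift_two _ _)).trans (shift_two _ _)
  · simpa [add_assoc] using (shift_two a b).trans (shift_two _ _)
  · exact shift_two a b

theorem latticeCongruent_region_of_width_eq {a b a' b' : Fin 3 → ℤ}
    (h_width : ∀ j, b j - a j = b' j - a' j) (h_sum : ∑ j, a j = ∑ j, a' j) :
    LatticeCongruent (region a b) (region a' b') := by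
  refine ⟨0, (a' 0 - a 0, a' 1 - a 1), ?_⟩
  rw [show move 0 _ = translate _ from rfl, region_image_translate]
  simp only [Fin.sum_univ_three] at h_sum
  congr 1 <;> refine funext (Fin.forall_fin_succ.2 ?_) <;> simp [Fin.forall_fin_succ] at *
  all_goals omega

theorem sum_neg_shift_sub (a b : Fin 3 → ℤ) :
    ∑ j : Fin 3, (-a (j + 1) - -b (j + 1)) = ∑ j, (b j - a j) := by
  rw [← Equiv.sum_comp (Equiv.addRight (1 : Fin 3)) fun j => b j - a j]
  exact Finset.sum_congr rfl fun j _ => neg_sub_neg _ _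

theorem sum_neg_shift_add (a b : Fin 3 → ℤ) :
    ∑ j : Fin 3, (-b (j + 1) + -a (j + 1)) = -∑ j, (a j + b j) := by
  rw [← Equiv.sum_comp (Equiv.addRight (1 : Fin 3)) fun j => a j + b j, ← Finset.sum_neg_distrib]
  exact Finset.sum_congr rfl fun j _ => (neg_add_rev _ _).symm

theorem IsBalanced.neg_shift {a b : Fin 3 → ℤ} (h : IsBalanced a b) :
    IsBalanced (fun j => -b (j + 1)) fun j => -a (j + 1) where
  width_le j k := by
    have := h.width_le (j + 1) (k + 1)
    omega
  abs_sum_le := by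
    rw [sum_neg_shift_add, abs_neg]
    exact h.abs_sum_le

theorem IsBalanced.latticeCongruent_standardRegion {a b : Fin 3 → ℤ} (h : IsBalanced a b) :
    LatticeCongruent (region a b) (standardRegion (∑ j, (b j - a j))) := by
  wlog h_sum : ∑ j, (a j + b j) = (∑ j, (b j - a j)) % 2 generalizing a b
  · have h_parity := sum_add_emod_two a b
    have h_abs := abs_le.1 h.abs_sum_le
    have h_neg := this h.neg_shift (by rw [sum_neg_shift_add, sum_neg_shift_sub]; omega)
    rw [sum_neg_shift_sub] at h_neg
    exact (latticeCongruent_region_rotate a b).trans h_neg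
  obtain ⟨i, h₀, h₁, h₂⟩ : ∃ i, b i - a i = (∑ j, (b j - a j)) / 3 ∧
      b (i + 1) - a (i + 1) = ((∑ j, (b j - a j)) + 2) / 3 ∧
      b (i + 2) - a (i + 2) = ((∑ j, (b j - a j)) + 1) / 3 := by
    have h_width := (isBalanced_iff.1 h).1
    simp [Fin.exists_fin_succ, Fin.forall_fin_succ, Fin.sum_univ_three] at h_width ⊢
    omega
  refine (latticeCongruent_region_shift a b i).trans (latticeCongruent_region_of_width_eq ?_ ?_)
  · simp [Fin.forall_fin_succ, add_comm _ i, -Finset.sum_sub_distrib]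
    omega
  · have h_shift : ∑ j, a (j + i) = ∑ j, a j := Equiv.sum_comp (Equiv.addRight i) a
    rw [h_shift, Fin.sum_univ_three ![_, _, _]]
    simp [Finset.sum_add_distrib] at *
    omega

theorem IsBalancedRegion.image_translate {s : ℤ} {P : Finset Face} (h : IsBalancedRegion s P)
    (t : ℤ × ℤ) : IsBalancedRegion s (P.image (translate t)) := by
  obtain ⟨a, b, h, h_sum, rfl⟩ := h
  refine ⟨_, _, ⟨fun j k => ?_, ?_⟩, ?_, region_image_translate a b t⟩
  · simpa using h.width_le j k
  · have h_eq : ∑ j, ![t.1, t.2, -t.1 - t.2] j = 0 := by simp [Fin.sum_univ_three]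
    simpa [Finset.sum_add_distrib, h_eq] using h.abs_sum_le
  · simpa using h_sum

theorem IsBalancedRegion.image_rotate {s : ℤ} {P : Finset Face} (h : IsBalancedRegion s P) :
    IsBalancedRegion s (P.image rotate) := by
  obtain ⟨a, b, h, h_sum, rfl⟩ := h
  exact ⟨_, _, h.neg_shift, (sum_neg_shift_sub a b).trans h_sum, region_image_rotate a b⟩

theorem IsBalancedRegion.image_move {s : ℤ} {P : Finset Face} (h : IsBalancedRegion s P) (k : ℕ)
    (t : ℤ × ℤ) : IsBalancedRegion s (P.image (move k t)) := by
  induction k generalizing P with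
  | zero => exact h.image_translate t
  | succ k ih =>
    have h_image := ih h.image_rotate
    rwa [Finset.image_image] at h_image

theorem isBalancedRegion_iff_latticeCongruent {s : ℤ} {P : Finset Face} :
    IsBalancedRegion s P ↔ LatticeCongruent (standardRegion s) P := by
  constructor
  · rintro ⟨a, b, h, rfl, rfl⟩
    exact h.latticeCongruent_standardRegion.symm
  · rintro ⟨k, t, rfl⟩
    exact (isBalancedRegion_standardRegion s).image_move k t

theorem IsBalancedRegion.congr {s : ℤ} {P Q : Finset Face} (hP : IsBalancedRegion s P)
    (h : LatticeCongruent P Q) : IsBalancedRegion s Q :=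
  isBalancedRegion_iff_latticeCongruent.2 ((isBalancedRegion_iff_latticeCongruent.1 hP).trans h)

end NormalForm

section Bars

theorem one_le_barLength {r : ℕ} (hr : 1 ≤ r) (i : ℕ) : 1 ≤ barLength r i := by
  unfold barLength
  split_ifs <;> omega

theorem IsBalanced.upperSide_le_barLength {a b : Fin 3 → ℤ} {r i : ℕ} (h : IsBalanced a b)
    (hs : ∑ j, (b j - a j) = 6 * r + i) (hi : i ≤ 5) (j : Fin 3) :
    upperSide a b j ≤ barLength r i := by
  have h_width := h.width_le
  have h_abs := abs_le.1 h.abs_sum_le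
  simp only [sum_univ_eq_add_cyclic _ j, forall_fin_three_cyclic j, upperSide] at *
  unfold barLength
  interval_cases i <;> simp <;> omega

theorem IsBalanced.add_single_of_upperSide {a b : Fin 3 → ℤ} {r i : ℕ} (h : IsBalanced a b)
    (hs : ∑ j, (b j - a j) = 6 * r + i) (hi : i ≤ 5) {j : Fin 3}
    (h_side : upperSide a b j = barLength r i) : IsBalanced a (b + Pi.single j 1) := by
  obtain ⟨h_width, h_abs⟩ := h
  refine ⟨?_, ?_⟩ <;>
  · simp only [abs_le, sum_univ_eq_add_cyclic _ j, forall_fin_three_cyclic j, upperSide] at *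
    unfold barLength at h_side
    interval_cases i <;> simp at * <;> omega

theorem region_union_bar {a b : Fin 3 → ℤ} {l : ℕ} (hl : 1 ≤ l) (ha₀ : a 0 = 0) (hb₀ : l ≤ b 0)
    (ha₁ : a 1 ≤ 0) (hb₁ : b 1 = 0) (ha₂ : a 2 = -l) (hb₂ : 0 ≤ b 2) :
    region a b ∪ bar l = region a (b + Pi.single 1 1) := by
  ext f
  have := two_mul_coord_add_cyclic f 0
  have := sgn_eq_one_or_neg_one f
  rw [bar_eq_region hl]
  simp [mem_region, Fin.forall_fin_succ] at *
  omega

theorem eq_zero_and_le_upperSide_of_disjoint_bar {a b : Fin 3 → ℤ} {l : ℕ} (hl : 1 ≤ l)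
    (h_under : underBar l ⊆ region a b) (h_disj : Disjoint (region a b) (bar l)) :
    b 1 = 0 ∧ l ≤ upperSide a b 1 := by
  obtain ⟨⟨ha₀, hb₀⟩, ⟨ha₁, hb₁⟩, ha₂, hb₂⟩ := (underBar_subset_region_iff hl).1 h_under
  have h_notMem : ((0, 0, true) : Face) ∉ region a b := by
    refine Finset.disjoint_right.1 h_disj ?_
    rw [bar_eq_region hl]
    simp [mem_region_iff, coord]
    omega
  simp [mem_region_iff, coord, upperSide] at h_notMem ⊢
  omega

theorem IsBalancedRegion.attachBar {r i : ℕ} {Q P : Finset Face}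
    (hQ : IsBalancedRegion (6 * r + i) Q) (hr : 1 ≤ r) (hi : i ≤ 5)
    (h : AttachBar (barLength r i) Q P) : IsBalancedRegion (6 * r + (i + 1 : ℕ)) P := by
  have hl := one_le_barLength hr i
  obtain ⟨k, t, R, h_under, h_disj, hQR, rfl⟩ := attachBar_iff.1 h
  obtain ⟨a, b, h_balanced, h_sum, rfl⟩ := hQ.congr (LatticeCongruent.symm ⟨k, t, hQR⟩)
  obtain ⟨hb₁, h_le⟩ := eq_zero_and_le_upperSide_of_disjoint_bar hl h_under h_disj
  have h_side := (h_balanced.upperSide_le_barLength h_sum hi 1).antisymm h_le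
  obtain ⟨⟨ha₀, hb₀⟩, ⟨ha₁, -⟩, ha₂, hb₂⟩ := (underBar_subset_region_iff hl).1 h_under
  refine IsBalancedRegion.image_move ⟨_, _, h_balanced.add_single_of_upperSide h_sum hi h_side,
    ?_, ?_⟩ k t
  · simp [add_sub_right_comm, Finset.sum_add_distrib, h_sum, add_assoc, -Finset.sum_sub_distrib]
  · simp only [upperSide, Fin.reduceAdd] at h_side
    apply region_union_bar hl <;> omega

-- This is `standardRegion (s + 1)` without its top row.
theorem isBalancedRegion_standardRegion_removeTop (s : ℤ) : IsBalancedRegion s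
    (region ![0, 1 - (s + 1 + 2) / 3, (s + 1 + 2) / 3 - (s + 1) / 2 - 1]
      ![(s + 1) / 3, 0, (s + 1 + 1) / 2 - (s + 1) / 3 - 1]) := by
  refine ⟨_, _, ⟨?_, ?_⟩, ?_, rfl⟩
  · have : (s + 1 + 1) / 2 + (s + 1) / 2 = s + 1 := by omega
    simp [Fin.forall_fin_succ]
    omega
  · simp [Fin.sum_univ_three, abs_le]
    omega
  · simp [Fin.sum_univ_three]
    omega

theorem exists_attachBar_standardRegion {r i : ℕ} (hr : 1 ≤ r) (hi : i ≤ 5) :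
    ∃ Q, IsBalancedRegion (6 * r + i) Q ∧
      AttachBar (barLength r i) Q (standardRegion (6 * r + (i + 1 : ℕ))) := by
  have hl := one_le_barLength hr i
  have hl_eq : (barLength r i : ℤ) = (6 * r + i + 1) / 2 + 1 - (6 * r + i + 1 + 2) / 3 := by
    unfold barLength
    interval_cases i <;> simp <;> omega
  refine ⟨_, isBalancedRegion_standardRegion_removeTop _,
    attachBar_iff.2 ⟨0, 0, _, ?_, ?_, by rw [move_zero, Finset.image_id], ?_⟩⟩
  · rw [underBar_subset_region_iff hl]
    simp
    omega
  · rw [bar_eq_region hl, Finset.disjoint_left]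
    simp [mem_region_iff]
    omega
  · rw [move_zero, Finset.image_id, region_union_bar hl, standardRegion, Nat.cast_succ, ← add_assoc]
    · congr 1
      ext j
      fin_cases j <;> simp
    all_goals simp
    all_goals omega

theorem IsBalancedRegion.exists_superset {s : ℤ} {P : Finset Face} (h : IsBalancedRegion s P) :
    ∃ Q, IsBalancedRegion (s + 1) Q ∧ P ⊆ Q := by
  have h_lower :=
    isBalancedRegion_iff_latticeCongruent.1 (isBalancedRegion_standardRegion_removeTop s)
  obtain ⟨k, t, rfl⟩ := h_lower.symm.trans (isBalancedRegion_iff_latticeCongruent.1 h)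
  refine ⟨_, (isBalancedRegion_standardRegion (s + 1)).image_move k t,
    Finset.image_subset_image fun f hf => ?_⟩
  simp [standardRegion, mem_region_iff] at hf ⊢
  omega

end Bars

section QuasiRegularHexagons

theorem isRegularHexagon_iff {r : ℕ} {P : Finset Face} :
    IsRegularHexagon r P ↔ IsBalancedRegion (6 * r) P := by
  constructor
  · rintro ⟨t, rfl⟩
    refine IsBalancedRegion.image_translate ⟨_, _, ⟨?_, ?_⟩, ?_, hexagon_eq_region r⟩ t
    · simp
    · simp
    · simp
      ring
  · rintro ⟨a, b, h, h_sum, rfl⟩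
    refine ⟨(a 0 + r, a 1 + r), ?_⟩
    rw [hexagon_eq_region, region_image_translate]
    have h_width := h.width_le
    have h_abs := abs_le.1 h.abs_sum_le
    simp only [Fin.sum_univ_three, Fin.forall_fin_succ] at *
    congr 1 <;> refine funext (Fin.forall_fin_succ.2 ?_) <;> simp [Fin.forall_fin_succ] at * <;>
      omega

theorem IsBalancedRegion.exists_hexagon_superset {s : ℤ} {r : ℕ} {P : Finset Face}
    (h : IsBalancedRegion s P) (hs : s ≤ 6 * r) : ∃ H, IsRegularHexagon r H ∧ P ⊆ H := by
  simp only [isRegularHexagon_iff]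
  obtain ⟨n, hn⟩ := Int.le.dest hs
  induction n generalizing s P with
  | zero => exact ⟨P, by simpa [← hn] using h, subset_rfl⟩
  | succ n ih =>
    obtain ⟨Q, hQ, h_subset⟩ := h.exists_superset
    obtain ⟨H, hH, h_subset'⟩ := ih hQ (by omega) (by omega)
    exact ⟨H, hH, h_subset.trans h_subset'⟩

theorem isEB_iff {r i : ℕ} (hr : 1 ≤ r) (hi : i ≤ 6) {P : Finset Face} :
    IsEB r i P ↔ IsBalancedRegion (6 * r + i) P := by
  induction i generalizing P with
  | zero => simpa [IsEB] using isRegularHexagon_iff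
  | succ i ih =>
    have hi' : i ≤ 5 := by omega
    simp only [IsEB, ih (by omega)]
    constructor
    · rintro ⟨⟨Q, hQ, h_bar⟩, -⟩
      exact hQ.attachBar hr hi' h_bar
    · intro hP
      refine ⟨?_, hP.exists_hexagon_superset (by push_cast; omega)⟩
      obtain ⟨k, t, rfl⟩ := isBalancedRegion_iff_latticeCongruent.1 hP
      obtain ⟨Q, hQ, h_bar⟩ := exists_attachBar_standardRegion hr hi'
      exact ⟨_, hQ.image_move k t, h_bar.image_move k t⟩

theorem isQuasiRegularHexagon_iff {P : Finset Face} :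
    IsQuasiRegularHexagon P ↔ ∃ s : ℕ, 6 ≤ s ∧ IsBalancedRegion s P := by
  constructor
  · rintro ⟨r, i, hr, hi, hP⟩
    exact ⟨6 * r + i, by omega, by exact_mod_cast (isEB_iff hr hi).1 hP⟩
  · rintro ⟨s, hs, hP⟩
    refine ⟨s / 6, s % 6, by omega, by omega, (isEB_iff (by omega) (by omega)).2 ?_⟩
    exact_mod_cast (Nat.div_add_mod s 6).symm ▸ hP

end QuasiRegularHexagons

end TriLattice

theorem mainTheorem8 :
    (∀ s : ℕ, 6 ≤ s → ∀ P : Finset Face,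
      IsAreaMaximizer s P ↔ IsQuasiRegularHexagon P ∧ sitePerimeter P = s) ∧
    (∀ r i : ℕ, 1 ≤ r → i ≤ 5 →
      (∀ P : Finset Face, IsAreaMaximizer (6 * r + i) P ↔ IsEB r i P) ∧
      ∃ E : Finset Face, IsEB r i E ∧ ∀ P : Finset Face, IsEB r i P ↔ LatticeCongruent E P) := by
  refine ⟨fun s hs P => ?_, fun r i hr hi => ?_⟩
  · rw [isAreaMaximizer_iff (by omega), isQuasiRegularHexagon_iff]
    constructor
    · intro hP
      exact ⟨⟨s, hs, hP⟩, Nat.cast_injective (hP.sitePerimeter_eq (by omega))⟩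
    · rintro ⟨⟨s', hs', hP⟩, rfl⟩
      rwa [hP.sitePerimeter_eq (by omega)]
  · simp only [isEB_iff hr (Nat.le_succ_of_le hi)]
    refine ⟨fun P => ?_, standardRegion (6 * r + i), isBalancedRegion_standardRegion _,
      fun P => isBalancedRegion_iff_latticeCongruent⟩
    rw [isAreaMaximizer_iff (by omega), Nat.cast_add, Nat.cast_mul, Nat.cast_ofNat]
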